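/- For $n\ge 0$ let $\pi=\pi_1\cdots\pi_n$ be a permutation of $\{1,\dots,n\}$ (the empty permutation if $n=0$), and write $|\pi|=n$. An index $2\le \ell\le n-1$ is a valley of $\pi$ if $\pi_{\ell-1}>\pi_\ell<\pi_{\ell+1}$, and a peak if $\pi_{\ell-1}<\pi_\ell>\pi_{\ell+1}$; let $\mathsf{val}(\pi)$ and $\mathsf{peak}(\pi)$ be the numbers of valleys and peaks. The permutation $\pi$ is increasing if the values $\pi_\ell$ at its valleys $\ell$ increase from left to right. Let $\mathcal I$ be the set of all increasing permutations (of all lengths $n\ge 0$). For $a,b\in\{0,1\}$ let $\mathcal I^{a,b}$ be the set of $\pi\in\mathcal I$ such that $a=0$ if and only if $\pi$ does not start with a descent, and $b=0$ if and only if $\pi$ does not end with an ascent, where $\pi$ starts with a descent if $n\ge 2$ and $\pi_1>\pi_2$, and ends with an ascent if $n\ge2$ and $\pi_{n-1}<\pi_n$. Define the formal power series $$I^{\mathsf{peak}}(x,y)=\sum_{\pi\in\mathcal I}\frac{x^{|\pi|}}{|\pi|!}y^{\mathsf{peak}(\pi)},\qquad I^{a,b}(x,y)=\sum_{\pi\in\mathcal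 I^{a,b}}\frac{x^{|\pi|}}{|\pi|!}y^{\mathsf{val}(\pi)}$$ in $\mathbb Q[[x,y]]$, where integrals are taken term by term. **Theorem 2.12.** The series $I^{1,1}(x,y)$ is divisible by $y$, and $$I^{\mathsf{peak}}(x,y)=1+x+y\bigl(I^{0,0}(x,y)-1-x\bigr)+I^{0,1}(x,y)+\frac1y I^{1,1}(x,y)+I^{1,0}(x,y),$$ where $$I^{0,1}(x,y)=e^{\frac{y e^{2x}}{4}-\frac{xy}{2}+x}\int_0^x e^{-\frac{y e^{2t}}{4}+\frac{ty}{2}-t}\,dt-y\int_0^x\left(e^{\frac{ye^{2t}}{4}-\frac{ty}{2}+t}(e^t-1)\int_0^t e^{-\frac{ye^{2u}}{4}+\frac{yu}{2}-u}\,du\right)dt-x,$$ $$I^{1,1}(x,y)=y\int_0^x\left(e^{\frac{ye^{2t}}{4}-\frac{ty}{2}+t}(e^t-1)\int_0^t e^{-\frac{ye^{2u}}{4}+\frac{yu}{2}-u}\,du\right)dt,$$ $$I^{1,0}(x,y)=y\int_0^x(e^t-1)\bigl(I^{0,0}(t,y)+I^{1,0}(t,y)-t-1\bigr)dt+\int_0^x\bigl(I^{1,0}(t,y)+I^{1,1}(t,y)+t\bigr)dt,$$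 $$I^{0,0}(x,y)=1+x+\frac y2\int_0^x(e^t-1)^2\bigl(I^{0,0}(t,y)+I^{1,0}(t,y)-t-1\bigr)dt+\int_0^x\bigl(I^{0,0}(t,y)+I^{1,0}(t,y)-t-1\bigr)dt+\int_0^x\bigl(I^{0,0}(t,y)+I^{0,1}(t,y)-t-1\bigr)dt.$$ -/

import Mathlib

namespace IncPerm

/-- The index `i` is a valley of `π = π₀ π₁ ⋯ πₙ₋₁`: it has a left neighbour `j` and a right
neighbour `k`, and `π j > π i < π k`. -/
def IsValley {n : ℕ} (π : Equiv.Perm (Fin n)) (i : Fin n) : Prop :=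
  ∃ j k : Fin n, (j : ℕ) + 1 = i ∧ (i : ℕ) + 1 = k ∧ π i < π j ∧ π i < π k

/-- The index `i` is a peak of `π`: it has a left neighbour `j` and a right neighbour `k`, and
`π j < π i > π k`. -/
def IsPeak {n : ℕ} (π : Equiv.Perm (Fin n)) (i : Fin n) : Prop :=
  ∃ j k : Fin n, (j : ℕ) + 1 = i ∧ (i : ℕ) + 1 = k ∧ π j < π i ∧ π k < π i

instance {n : ℕ} (π : Equiv.Perm (Fin n)) : DecidablePred (IsValley π) := fun i => by
  unfold IsValley; infer_instance

instance {n : ℕ} (π : Equiv.Perm (Fin n)) : DecidablePred (IsPeak π) := fun i => by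
  unfold IsPeak; infer_instance

/-- The number of valleys. -/
def val {n : ℕ} (π : Equiv.Perm (Fin n)) : ℕ := (Finset.univ.filter (IsValley π)).card

/-- The number of peaks. -/
def peak {n : ℕ} (π : Equiv.Perm (Fin n)) : ℕ := (Finset.univ.filter (IsPeak π)).card

/-- The heights of the valleys increase from left to right. -/
def IsIncreasing {n : ℕ} (π : Equiv.Perm (Fin n)) : Prop :=
  ∀ i j : Fin n, IsValley π i → IsValley π j → i < j → π i < π j

instance {n : ℕ} : DecidablePred (IsIncreasing (n := n)) := fun π => by
  unfold IsIncreasing; infer_instance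

/-- The length is at least two and the first entry exceeds the second. -/
def StartsWithDescent {n : ℕ} (π : Equiv.Perm (Fin n)) : Prop :=
  ∃ i j : Fin n, (i : ℕ) = 0 ∧ (j : ℕ) = 1 ∧ π j < π i

/-- The length is at least two and the last entry exceeds the one before it. -/
def EndsWithAscent {n : ℕ} (π : Equiv.Perm (Fin n)) : Prop :=
  ∃ i j : Fin n, (i : ℕ) + 1 = j ∧ (j : ℕ) + 1 = n ∧ π i < π j

instance {n : ℕ} : DecidablePred (StartsWithDescent (n := n)) := fun π => by
  unfold StartsWithDescent; infer_instance

instance {n : ℕ} : DecidablePred (EndsWithAscent (n := n)) := fun π => by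
  unfold EndsWithAscent; infer_instance

/-- The increasing permutations of length `n`. -/
def inc (n : ℕ) : Finset (Equiv.Perm (Fin n)) := Finset.univ.filter IsIncreasing

/-- The increasing permutations of length `n` that do not start with a descent if and only if
`a = 0`, and do not end with an ascent if and only if `b = 0`. -/
def incAB (a b : Fin 2) (n : ℕ) : Finset (Equiv.Perm (Fin n)) :=
  (inc n).filter fun π => (¬ StartsWithDescent π ↔ a = 0) ∧ (¬ EndsWithAscent π ↔ b = 0)

/-- Formal power series in `x` (variable `0`) and `y` (variable `1`) over `ℚ`. -/
abbrev Series : Type := MvPowerSeries (Fin 2) ℚ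

/-- The variable marking the length. -/
noncomputable def x : Series := MvPowerSeries.X 0

/-- The variable marking the statistic. -/
noncomputable def y : Series := MvPowerSeries.X 1

/-- The bivariate generating function of the class `C` with respect to the statistic `s`,
exponential in the length: the coefficient of `xⁿ yᵏ / n!` is the number of `π ∈ C n`
with `s π = k`. -/
def egf (C : (n : ℕ) → Finset (Equiv.Perm (Fin n)))
    (s : (n : ℕ) → Equiv.Perm (Fin n) → ℕ) : Series :=
  fun m => (((C (m 0)).filter fun π => s (m 0) π = m 1).card : ℚ) / (Nat.factorial (m 0) : ℚ)

/-- The generating function of increasing permutations by length and number of peaks. -/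
def Ipeak : Series := egf inc fun _ => peak

/-- The generating function of the class `incAB a b` by length and number of valleys. -/
def I (a b : Fin 2) : Series := egf (incAB a b) fun _ => val

/-- The exponential of a formal power series without constant term: `exp F = ∑ Fᵏ / k!`. -/
noncomputable def exp (F : Series) : Series := (PowerSeries.exp ℚ).subst F

/-- The formal integral `∫₀ˣ F(t, y) dt`: it sends `xⁿ yᵏ` to `xⁿ⁺¹ yᵏ / (n + 1)`. -/
noncomputable def integral (F : Series) : Series := fun m =>
  if m 0 = 0 then 0 else MvPowerSeries.coeff (m - Finsupp.single 0 1) F / (m 0 : ℚ)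

/-- A rational number as a constant series. -/
noncomputable def const (q : ℚ) : Series := MvPowerSeries.C q

/-- The series `exp (y e^{2x} / 4 - x y / 2 + x)`. -/
noncomputable def E : Series :=
  exp (const (1 / 4) * y * exp (2 * x) - const (1 / 2) * x * y + x)

/-- The series `exp (- y e^{2x} / 4 + x y / 2 - x)`. -/
noncomputable def Eneg : Series :=
  exp (-(const (1 / 4) * y * exp (2 * x)) + const (1 / 2) * x * y - x)

end IncPerm

/-! Remove the least entry `m` of a permutation, writing it as `σ m τ`. If both sides are nonempty,
`m` is a valley, lower than every other one, so the valleys increase exactly when `σ` has no valley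
and `τ` is increasing (`incList_append_cons`). If a side is empty, `m` is not a valley and the other
side is any increasing word. Whether the whole starts with a descent can be read from `σ`, and
whether it ends with an ascent from `τ`; a one-entry side counts as a descent towards `m` or as an
ascent away from it, which is the content of `Front`.

For exponential generating functions, removing the least entry is differentiation in `x`, and
distributing the remaining entries over the two sides is multiplication (`dx_weightGen`). This gives
`dx_incGen_ends`, a linear differential system for the four series `I a b`. Its coefficients come
from the valley-free words: `exp x - 1` for those with front type `1` and `(exp x - 1) ^ 2 / 2` for
front type `0`. Both follow from the same decomposition, since the least entry of a valley-free word
is at an end.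

Integrating the system gives the equations for `I 1 0` and `I 0 0`. The sum `I 0 1 + I 1 1 + x`
satisfies a scalar linear equation by itself, with integrating factor `Eneg = 1 / E`; this gives the
closed forms. Every identity is proved by comparing derivatives in `x` and values at `x = 0`.

The peak formula rests on `length_peaks_add`: in a word of length at least two, peaks and valleys
alternate, so their numbers differ by `1`, `0` or `-1` according to the two ends. -/

namespace IncPerm

open MvPowerSeries

/-! ### Formal calculus in `x`: derivative, integral, uniqueness for linear equations -/

/-- The partial derivative with respect to `x`. -/
noncomputable abbrev dx : Derivation ℚ Series Series := MvPowerSeries.pderiv ℚ 0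

/-- The series `F` vanishes at `x = 0`. -/
def VanishesAtZero (F : Series) : Prop := ∀ m : Fin 2 →₀ ℕ, m 0 = 0 → coeff m F = 0

theorem VanishesAtZero.add {F G : Series} (hF : VanishesAtZero F) (hG : VanishesAtZero G) :
    VanishesAtZero (F + G) := fun m hm => by rw [map_add, hF m hm, hG m hm, add_zero]

theorem VanishesAtZero.sub {F G : Series} (hF : VanishesAtZero F) (hG : VanishesAtZero G) :
    VanishesAtZero (F - G) := fun m hm => by rw [map_sub, hF m hm, hG m hm, sub_zero]

theorem VanishesAtZero.mul_left {F : Series} (G : Series) (hF : VanishesAtZero F) :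
    VanishesAtZero (G * F) := fun m hm => by
  rw [coeff_mul]
  refine Finset.sum_eq_zero fun p hp => ?_
  have h : p.1 0 + p.2 0 = m 0 := by
    rw [← Finsupp.add_apply, Finset.HasAntidiagonal.mem_antidiagonal.mp hp]
  rw [hF p.2 (by omega), mul_zero]

theorem vanishesAtZero_x : VanishesAtZero x := fun m hm => by
  rw [x, coeff_X, if_neg]
  rintro rfl
  simp at hm

theorem vanishesAtZero_integral (F : Series) : VanishesAtZero (integral F) := fun m hm => by
  rw [coeff_apply, integral, if_pos hm]

theorem dx_integral (F : Series) : dx (integral F) = F := by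
  ext m
  rw [coeff_pderiv, coeff_apply (integral F), integral, if_neg (by simp)]
  have h : ((m 0 : ℚ) + 1) ≠ 0 := by positivity
  simp [h]

/-- Linear differential equations in `x` have at most one solution that vanishes at `x = 0`. -/
theorem eq_zero_of_dx_eq_mul {A F : Series} (hF : VanishesAtZero F) (h : dx F = A * F) :
    F = 0 := by
  have key : ∀ n : ℕ, ∀ m : Fin 2 →₀ ℕ, m 0 = n → coeff m F = 0 := by
    intro n
    induction n using Nat.strong_induction_on with
    | _ n ih =>
      intro m hm
      obtain rfl | hn := Nat.eq_zero_or_pos n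
      · exact hF m hm
      have hle : Finsupp.single 0 1 ≤ m := by
        rw [Finsupp.single_le_iff]; omega
      -- On the left this coefficient is a positive multiple of the coefficient of `F` at `m`; on
      -- the right only coefficients of `F` with a smaller power of `x` occur.
      have e := congrArg (coeff (m - Finsupp.single 0 1)) h
      rw [coeff_pderiv, tsub_add_cancel_of_le hle, coeff_mul,
        Finset.sum_eq_zero (fun p hp => ?_)] at e
      · refine (mul_eq_zero.mp e).resolve_right ?_
        positivity
      · have hp' : p.1 0 + p.2 0 = m 0 - 1 := by
          rw [← Finsupp.add_apply, Finset.HasAntidiagonal.mem_antidiagonal.mp hp]; simp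
        rw [ih (p.2 0) (by omega) p.2 rfl, mul_zero]
  ext m
  simpa using key _ m rfl

theorem eq_of_dx_eq {A B F G : Series} (h0 : VanishesAtZero (F - G)) (hF : dx F = A * F + B)
    (hG : dx G = A * G + B) : F = G :=
  sub_eq_zero.mp (eq_zero_of_dx_eq_mul (A := A) h0 (by rw [map_sub, hF, hG]; ring))

theorem eq_of_dx_eq_dx {F G : Series} (h0 : VanishesAtZero (F - G)) (h : dx F = dx G) : F = G :=
  eq_of_dx_eq (A := 0) (B := dx G) h0 (by rw [h]; ring) (by ring)

/-! ### The exponential -/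

theorem hasSubst_of_constantCoeff {F : Series} (hF : constantCoeff F = 0) :
    PowerSeries.HasSubst F := PowerSeries.HasSubst.of_constantCoeff_zero hF

theorem coeff_pow_eq_zero {F : Series} (hF : constantCoeff F = 0) {k : ℕ} {m : Fin 2 →₀ ℕ}
    (h : m.degree < k) : coeff m (F ^ k) = 0 := by
  apply coeff_of_lt_order
  refine lt_of_lt_of_le (by exact_mod_cast h) (le_order_pow_of_constantCoeff_eq_zero k hF)

/-- The chain rule holds for polynomials `f` because `pderiv` is a derivation. A fixed coefficient
of either side depends only on a truncation of `f`, since `F ^ k` has order at least `k`. -/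
theorem pderiv_subst {F : Series} (hF : constantCoeff F = 0) (f : PowerSeries ℚ) (i : Fin 2) :
    pderiv ℚ i (f.subst F) = (PowerSeries.derivative ℚ f).subst F * pderiv ℚ i F := by
  have hS := hasSubst_of_constantCoeff hF
  have hpoly (p : Polynomial ℚ) : pderiv ℚ i ((p : PowerSeries ℚ).subst F)
      = (PowerSeries.derivative ℚ (p : PowerSeries ℚ)).subst F * pderiv ℚ i F := by
    rw [PowerSeries.subst_coe hS, PowerSeries.derivative_coe, PowerSeries.subst_coe hS,
      Derivation.comp_aeval_eq (a := F) (pderiv ℚ i) p, smul_eq_mul]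
  ext m
  -- The coefficient before differentiation sits in degree `m.degree + 1`, so the powers of `F` from
  -- `m.degree + 2` on do not reach it.
  set N := m.degree + 2 with hN
  have htr : coeff (m + Finsupp.single i 1) (f.subst F)
      = coeff (m + Finsupp.single i 1) ((PowerSeries.trunc N f : PowerSeries ℚ).subst F) := by
    rw [PowerSeries.coeff_subst hS, PowerSeries.coeff_subst hS]
    refine finsum_congr fun d => ?_
    obtain hd | hd := lt_or_ge d N
    · rw [PowerSeries.coeff_coe_trunc_of_lt hd]
    · rw [coeff_pow_eq_zero hF (by simp; omega), smul_zero, smul_zero]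
  rw [coeff_pderiv, htr, ← coeff_pderiv, hpoly, coeff_mul, coeff_mul]
  refine Finset.sum_congr rfl fun p hp => ?_
  congr 1
  rw [PowerSeries.coeff_subst hS, PowerSeries.coeff_subst hS]
  have hpd : p.1.degree + p.2.degree = m.degree := by
    rw [← map_add, Finset.HasAntidiagonal.mem_antidiagonal.mp hp]
  refine finsum_congr fun d => ?_
  obtain hd | hd := lt_or_ge (d + 1) N
  · rw [PowerSeries.coeff_derivative, PowerSeries.coeff_derivative,
      PowerSeries.coeff_coe_trunc_of_lt hd]
  · rw [coeff_pow_eq_zero hF (by omega), smul_zero, smul_zero]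

theorem pderiv_exp {F : Series} (hF : constantCoeff F = 0) (i : Fin 2) :
    pderiv ℚ i (exp F) = exp F * pderiv ℚ i F := by
  rw [exp, pderiv_subst hF, PowerSeries.derivative_exp]

theorem constantCoeff_exp {F : Series} (hF : constantCoeff F = 0) :
    constantCoeff (exp F) = 1 := by
  have hS := hasSubst_of_constantCoeff hF
  have h := PowerSeries.constantCoeff_subst_eq_zero hF (PowerSeries.exp ℚ - 1) (by simp)
  have h1 : (1 : PowerSeries ℚ).subst F = 1 := by
    rw [← PowerSeries.coe_substAlgHom hS, map_one]
  rw [PowerSeries.subst_sub hS, h1, map_sub, map_one, sub_eq_zero] at h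
  exact h

theorem exp_mul_exp_neg {F : Series} (hF : constantCoeff F = 0) : exp F * exp (-F) = 1 := by
  have hF' : constantCoeff (-F) = 0 := by rw [map_neg, hF, neg_zero]
  refine pderiv.ext (fun i => ?_) ?_
  · rw [Derivation.leibniz, pderiv_exp hF, pderiv_exp hF', map_neg, pderiv_one]
    simp only [smul_eq_mul]
    ring
  · rw [map_mul, constantCoeff_exp hF, constantCoeff_exp hF', map_one, one_mul]

/-- As for `exp_mul_exp_neg`: the product `exp (F + G) * exp (-F) * exp (-G)` has vanishing partial
derivatives in both variables and constant term `1`. -/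
theorem exp_add {F G : Series} (hF : constantCoeff F = 0) (hG : constantCoeff G = 0) :
    exp (F + G) = exp F * exp G := by
  have hF' : constantCoeff (-F) = 0 := by rw [map_neg, hF, neg_zero]
  have hG' : constantCoeff (-G) = 0 := by rw [map_neg, hG, neg_zero]
  have hFG : constantCoeff (F + G) = 0 := by rw [map_add, hF, hG, add_zero]
  have key : exp (F + G) * (exp (-F) * exp (-G)) = 1 := by
    refine pderiv.ext (fun i => ?_) ?_
    · simp only [Derivation.leibniz, pderiv_exp hFG, pderiv_exp hF', pderiv_exp hG', map_neg,
        map_add, pderiv_one, smul_eq_mul]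
      ring
    · simp only [map_mul, constantCoeff_exp hFG, constantCoeff_exp hF', constantCoeff_exp hG',
        map_one, one_mul]
  calc exp (F + G) = exp (F + G) * (exp F * exp (-F)) * (exp G * exp (-G)) := by
        rw [exp_mul_exp_neg hF, exp_mul_exp_neg hG, mul_one, mul_one]
    _ = exp (F + G) * (exp (-F) * exp (-G)) * (exp F * exp G) := by ring
    _ = exp F * exp G := by rw [key, one_mul]

theorem constantCoeff_x : constantCoeff x = 0 := by simp [x]

theorem constantCoeff_y : constantCoeff y = 0 := by simp [y]

theorem dx_x : dx x = 1 := pderiv_X_self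

theorem dx_y : dx y = 0 := pderiv_X_of_ne (by decide)

theorem dx_exp_x : dx (exp x) = exp x := by
  rw [dx, pderiv_exp constantCoeff_x, dx_x, mul_one]

theorem exp_two_mul_x : exp (2 * x) = exp x ^ 2 := by
  rw [two_mul, exp_add constantCoeff_x constantCoeff_x, sq]

theorem vanishesAtZero_exp_x_sub_one : VanishesAtZero (exp x - 1) := fun m hm => by
  have h1 : (1 : PowerSeries ℚ).subst x = 1 := by
    rw [← PowerSeries.coe_substAlgHom (hasSubst_of_constantCoeff constantCoeff_x), map_one]
  have hS := hasSubst_of_constantCoeff constantCoeff_x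
  rw [exp, ← h1, ← PowerSeries.subst_sub hS, PowerSeries.coeff_subst hS]
  refine finsum_eq_zero_of_forall_eq_zero fun d => ?_
  obtain rfl | hd := Nat.eq_zero_or_pos d
  · simp
  · obtain ⟨e, rfl⟩ := Nat.exists_eq_add_of_lt hd
    rw [pow_succ, vanishesAtZero_x.mul_left _ m hm, smul_zero]

theorem E_mul_Eneg : E * Eneg = 1 := by
  rw [E, Eneg, ← exp_mul_exp_neg (F := const (1 / 4) * y * exp (2 * x) - const (1 / 2) * x * y + x)]
  · congr 2; ring
  · simp [constantCoeff_x, constantCoeff_y]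

theorem const_half_mul_two : const (1 / 2) * 2 = 1 := by
  rw [const, ← map_ofNat (C (σ := Fin 2) (R := ℚ)) 2, ← map_mul]
  norm_num

theorem dx_const (q : ℚ) : dx (const q) = 0 := pderiv_C

/-- The exponent has derivative `1 + y (e^{2x} - 1) / 2`, and `(e^{2x} - 1) / 2 = (e^x - 1) + (e^x -
1)^2 / 2`. The right-hand form matches the coefficient in the equation for `I 0 1 + I 1 1 + x`. -/
theorem dx_E : dx E = E * (1 + y * (exp x - 1) + const (1 / 2) * y * (exp x - 1) ^ 2) := by
  have h4 : const (1 / 4) * 2 = const (1 / 2) := by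
    rw [const, const, ← map_ofNat (C (σ := Fin 2) (R := ℚ)) 2, ← map_mul]; norm_num
  rw [E, dx, pderiv_exp (by simp [constantCoeff_x, constantCoeff_y]), exp_two_mul_x]
  congr 1
  simp only [map_add, map_sub, Derivation.leibniz, Derivation.leibniz_pow, smul_eq_mul, dx_x, dx_y,
    dx_const, dx_exp_x, nsmul_eq_mul]
  push_cast
  linear_combination (y * exp x ^ 2) * h4 + (y * exp x - y) * const_half_mul_two

/-! ### Exponential generating functions of sequences of polynomials -/

/-- The exponential generating function `∑ aₙ xⁿ / n!` of a sequence of polynomials in `y`. -/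
noncomputable def expGen (a : ℕ → Polynomial ℚ) : Series := fun m =>
  (a (m 0)).coeff (m 1) / ((m 0).factorial : ℚ)

theorem coeff_expGen (a : ℕ → Polynomial ℚ) (m : Fin 2 →₀ ℕ) :
    coeff m (expGen a) = (a (m 0)).coeff (m 1) / ((m 0).factorial : ℚ) := rfl

theorem expGen_add (a b : ℕ → Polynomial ℚ) :
    expGen (fun n => a n + b n) = expGen a + expGen b := by
  ext m
  simp only [map_add, coeff_expGen, Polynomial.coeff_add, add_div]

theorem expGen_zero : expGen (fun _ => 0) = 0 := by
  ext m
  simp [coeff_expGen]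

theorem expGen_sum {ι : Type*} (s : Finset ι) (a : ι → ℕ → Polynomial ℚ) :
    expGen (fun n => ∑ i ∈ s, a i n) = ∑ i ∈ s, expGen (a i) := by
  classical
  induction s using Finset.induction_on with
  | empty => simpa using expGen_zero
  | insert i s hi ih => simp only [Finset.sum_insert hi, expGen_add, ih]

theorem dx_expGen (a : ℕ → Polynomial ℚ) : dx (expGen a) = expGen fun n => a (n + 1) := by
  ext m
  rw [coeff_pderiv, coeff_expGen, coeff_expGen]
  have h0 : (m + Finsupp.single 0 1 : Fin 2 →₀ ℕ) 0 = m 0 + 1 := by simp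
  have h1 : (m + Finsupp.single 0 1 : Fin 2 →₀ ℕ) 1 = m 1 := by simp
  have h : ((m 0).factorial : ℚ) ≠ 0 := by positivity
  have h' : (m 0 : ℚ) + 1 ≠ 0 := by positivity
  rw [h0, h1, Nat.factorial_succ]
  push_cast
  field_simp

theorem coeff_mul_eq_sum_sum (F G : Series) (m : Fin 2 →₀ ℕ) :
    coeff m (F * G) = ∑ p ∈ Finset.HasAntidiagonal.antidiagonal (m 0),
      ∑ q ∈ Finset.HasAntidiagonal.antidiagonal (m 1),
        coeff (Finsupp.single 0 p.1 + Finsupp.single 1 q.1) F *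
          coeff (Finsupp.single 0 p.2 + Finsupp.single 1 q.2) G := by
  have split (v : Fin 2 →₀ ℕ) : Finsupp.single 0 (v 0) + Finsupp.single 1 (v 1) = v := by
    ext i; fin_cases i <;> simp
  rw [coeff_mul, ← Finset.sum_product']
  refine Finset.sum_nbij' (fun p => ((p.1 0, p.2 0), (p.1 1, p.2 1)))
    (fun p => (Finsupp.single 0 p.1.1 + Finsupp.single 1 p.2.1,
      Finsupp.single 0 p.1.2 + Finsupp.single 1 p.2.2)) ?_ ?_ ?_ ?_ ?_
  · intro p hp
    rw [Finset.HasAntidiagonal.mem_antidiagonal] at hp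
    simp [← hp]
  · rintro ⟨p, q⟩ hp
    simp only [Finset.mem_product, Finset.HasAntidiagonal.mem_antidiagonal] at hp ⊢
    rw [add_add_add_comm, ← Finsupp.single_add, ← Finsupp.single_add, hp.1, hp.2, split]
  · intro p _
    simp only [split]
  · rintro ⟨p, q⟩ _
    simp
  · intro p _
    simp only [split]

theorem expGen_mul (a b : ℕ → Polynomial ℚ) :
    expGen a * expGen b =
      expGen fun n => ∑ i ∈ Finset.range (n + 1), n.choose i • (a i * b (n - i)) := by
  ext m
  rw [coeff_mul_eq_sum_sum, coeff_expGen, Finset.Nat.sum_antidiagonal_eq_sum_range_succ_mk,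
    Polynomial.finsetSum_coeff, Finset.sum_div]
  refine Finset.sum_congr rfl fun i hi => ?_
  have hi' : i ≤ m 0 := Nat.lt_succ_iff.mp (Finset.mem_range.mp hi)
  rw [Polynomial.coeff_smul, Polynomial.coeff_mul, nsmul_eq_mul, Nat.cast_choose ℚ hi',
    Finset.mul_sum, Finset.sum_div]
  refine Finset.sum_congr rfl fun q _ => ?_
  have h : ((m 0).factorial : ℚ) ≠ 0 := by positivity
  simp only [coeff_expGen, Finsupp.add_apply, Finsupp.single_eq_same]
  simp
  field_simp

/-! ### Arrangements of a finite set -/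

/-- The arrangements of a finite set of natural numbers: the lists that contain each of its
elements exactly once. -/
def arrangements (S : Finset ℕ) : Finset (List ℕ) :=
  ⟨Multiset.lists S.val, Multiset.lists_nodup_finset S⟩

theorem mem_arrangements {S : Finset ℕ} {l : List ℕ} :
    l ∈ arrangements S ↔ l.Nodup ∧ l.toFinset = S := by
  rw [arrangements, Finset.mem_mk, Multiset.mem_lists_iff]
  constructor
  · intro h
    have hn : l.Nodup := by
      have := S.nodup
      rw [h] at this
      exact this
    refine ⟨hn, ?_⟩
    rw [← Finset.val_inj, List.toFinset_val, hn.dedup, h]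
    rfl
  · rintro ⟨hn, rfl⟩
    rw [List.toFinset_val, hn.dedup]
    rfl

theorem mem_of_mem_arrangements {S : Finset ℕ} {l : List ℕ} (hl : l ∈ arrangements S) {i : ℕ} :
    i ∈ l ↔ i ∈ S := by
  rw [← (mem_arrangements.mp hl).2, List.mem_toFinset]

theorem arrangements_empty : arrangements ∅ = {[]} := by
  ext l
  rw [mem_arrangements, Finset.mem_singleton, List.toFinset_eq_empty_iff]
  exact ⟨fun h => h.2, fun h => ⟨h ▸ List.nodup_nil, h⟩⟩

/-- Since `m` occurs exactly once, cutting at `m` is a bijection; `A` is the set of entries to its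
left. -/
theorem sum_arrangements_insert {S : Finset ℕ} {m : ℕ} (hm : m ∉ S)
    {M : Type*} [AddCommMonoid M] (f : List ℕ → M) :
    ∑ l ∈ arrangements (insert m S), f l =
      ∑ A ∈ S.powerset, ∑ σ ∈ arrangements A, ∑ τ ∈ arrangements (S \ A), f (σ ++ m :: τ) := by
  simp only [← Finset.sum_product']
  rw [Finset.sum_sigma']
  symm
  refine Finset.sum_bij (fun p _ => p.2.1 ++ m :: p.2.2) ?_ ?_ ?_ ?_
  · rintro ⟨A, σ, τ⟩ h
    simp only [Finset.mem_sigma, Finset.mem_powerset, Finset.mem_product, mem_arrangements] at h ⊢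
    obtain ⟨hA, ⟨hσ, rfl⟩, hτ, hτA⟩ := h
    have h1 : ∀ i, i ∈ τ ↔ i ∈ S ∧ i ∉ σ := fun i => by
      rw [← List.mem_toFinset, hτA, Finset.mem_sdiff, List.mem_toFinset]
    have h2 : ∀ i ∈ σ, i ∈ S := fun i hi => hA (List.mem_toFinset.mpr hi)
    constructor
    · rw [List.nodup_append]
      refine ⟨hσ, List.nodup_cons.mpr ⟨fun h => hm ((h1 m).mp h).1, hτ⟩, ?_⟩
      rintro i hi j hj rfl
      rcases List.mem_cons.mp hj with rfl | hj
      · exact hm (h2 _ hi)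
      · exact ((h1 i).mp hj).2 hi
    · ext i
      simp only [List.mem_toFinset, List.mem_append, List.mem_cons, Finset.mem_insert, h1]
      by_cases hi : i ∈ σ
      · simp [hi, h2 i hi]
      · simp [hi]
  · rintro ⟨A, σ, τ⟩ h ⟨A', σ', τ'⟩ h' e
    simp only [Finset.mem_sigma, Finset.mem_powerset, Finset.mem_product] at h h' e
    have hσ : m ∉ σ := fun hh => hm (h.1 ((mem_of_mem_arrangements h.2.1).mp hh))
    have hσ' : m ∉ σ' := fun hh => hm (h'.1 ((mem_of_mem_arrangements h'.2.1).mp hh))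
    have hτ : m ∉ τ := fun hh =>
      hm (Finset.mem_sdiff.mp ((mem_of_mem_arrangements h.2.2).mp hh)).1
    obtain ⟨rfl, -, rfl⟩ := (List.append_cons_inj_of_notMem hσ hτ).mp e
    obtain rfl : A = A' := by
      rw [← (mem_arrangements.mp h.2.1).2, (mem_arrangements.mp h'.2.1).2]
    rfl
  · intro l hl
    have hml : m ∈ l := (mem_of_mem_arrangements hl).mpr (Finset.mem_insert_self _ _)
    obtain ⟨σ, τ, rfl⟩ := List.append_of_mem hml
    obtain ⟨hn, hS⟩ := mem_arrangements.mp hl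
    rw [List.nodup_append, List.nodup_cons] at hn
    obtain ⟨hσ, ⟨hmτ, hτ⟩, hd⟩ := hn
    have hmσ : m ∉ σ := fun h => hd m h m List.mem_cons_self rfl
    have hS' : ∀ i, (i ∈ σ ∨ i = m ∨ i ∈ τ) ↔ (i = m ∨ i ∈ S) := fun i => by
      have := congrArg (i ∈ ·) hS
      simp only [List.mem_toFinset, List.mem_append, List.mem_cons, Finset.mem_insert] at this
      exact iff_of_eq this
    refine ⟨⟨σ.toFinset, σ, τ⟩, ?_, rfl⟩
    simp only [Finset.mem_sigma, Finset.mem_powerset, Finset.mem_product, mem_arrangements]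
    refine ⟨fun i hi => ?_, ⟨hσ, trivial⟩, hτ, ?_⟩
    · rw [List.mem_toFinset] at hi
      exact ((hS' i).mp (Or.inl hi)).resolve_left fun h => hmσ (h ▸ hi)
    · ext i
      rw [Finset.mem_sdiff, List.mem_toFinset, List.mem_toFinset]
      constructor
      · intro hi
        exact ⟨((hS' i).mp (Or.inr (Or.inr hi))).resolve_left fun h => hmτ (h ▸ hi),
          fun h => hd i h i (List.mem_cons_of_mem _ hi) rfl⟩
      · rintro ⟨hi, hiσ⟩
        rcases (hS' i).mpr (Or.inr hi) with h | rfl | h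
        · exact absurd h hiσ
        · exact absurd hi hm
        · exact h
  · intros; rfl

/-! ### Weights on lists -/

/-- A function on lists is order invariant if it only depends on the relative order of the
entries. -/
def OrderInvariant {β : Type*} (f : List ℕ → β) : Prop :=
  ∀ φ : ℕ → ℕ, StrictMono φ → ∀ l, f (l.map φ) = f l

/-- The total weight of the arrangements of `{0, …, n - 1}`. -/
noncomputable def total (f : List ℕ → Polynomial ℚ) (n : ℕ) : Polynomial ℚ :=
  ∑ l ∈ arrangements (Finset.range n), f l

theorem exists_strictMono_image (A : Finset ℕ) :
    ∃ φ : ℕ → ℕ, StrictMono φ ∧ (Finset.range A.card).image φ = A := by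
  classical
  -- Order invariance asks for maps that are strictly monotone on all of `ℕ`, so the enumeration of
  -- `A` is continued by values above its maximum.
  refine ⟨fun i => if h : i < A.card then A.orderEmbOfFin rfl ⟨i, h⟩ else A.sup id + 1 + i, ?_, ?_⟩
  · intro i j hij
    dsimp only
    split_ifs with hi hj hj
    · exact (A.orderEmbOfFin rfl).strictMono hij
    · have : A.orderEmbOfFin rfl ⟨i, hi⟩ ≤ A.sup id :=
        Finset.le_sup (f := id) (A.orderEmbOfFin_mem rfl _)
      omega
    · omega
    · omega
  · ext k
    rw [Finset.mem_image]
    constructor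
    · rintro ⟨i, hi, rfl⟩
      rw [dif_pos (Finset.mem_range.mp hi)]
      exact A.orderEmbOfFin_mem rfl _
    · intro hk
      have : k ∈ Set.range (A.orderEmbOfFin rfl) := by rwa [Finset.range_orderEmbOfFin]
      obtain ⟨i, rfl⟩ := this
      exact ⟨i, Finset.mem_range.mpr i.2, dif_pos i.2⟩

theorem sum_arrangements_image (S : Finset ℕ) {φ : ℕ → ℕ} (hφ : Function.Injective φ)
    {M : Type*} [AddCommMonoid M] (f : List ℕ → M) :
    ∑ l ∈ arrangements (S.image φ), f l = ∑ l ∈ arrangements S, f (l.map φ) := by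
  symm
  refine Finset.sum_bij (fun l _ => l.map φ) ?_ ?_ ?_ ?_
  · intro l hl
    obtain ⟨hn, rfl⟩ := mem_arrangements.mp hl
    refine mem_arrangements.mpr ⟨hn.map hφ, ?_⟩
    ext; simp
  · intro l _ l' _ h
    exact List.map_injective_iff.mpr hφ h
  · intro l hl
    obtain ⟨hn, hS⟩ := mem_arrangements.mp hl
    have hmem : ∀ i ∈ l, ∃ j ∈ S, φ j = i := fun i hi => by
      rwa [← List.mem_toFinset, hS, Finset.mem_image] at hi
    obtain ⟨l', rfl⟩ : ∃ l', List.map φ l' = l := by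
      have : l ∈ Set.range (List.map φ) := by
        rw [Set.range_list_map]
        exact fun i hi => (hmem i hi).imp fun j hj => hj.2
      exact this
    refine ⟨l', mem_arrangements.mpr ⟨hn.of_map φ, ?_⟩, rfl⟩
    apply Finset.image_injective hφ
    rw [← hS]
    ext; simp
  · intros; rfl

/-- Relabelling `A` increasingly by `0, 1, …` preserves the weight, so only the cardinality matters.
This turns sums over subsets into binomial convolutions. -/
theorem OrderInvariant.sum_arrangements {f : List ℕ → Polynomial ℚ} (hf : OrderInvariant f)
    (A : Finset ℕ) : ∑ l ∈ arrangements A, f l = total f A.card := by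
  obtain ⟨φ, hφ, hA⟩ := exists_strictMono_image A
  conv_lhs => rw [← hA, sum_arrangements_image _ hφ.injective]
  exact Finset.sum_congr rfl fun l _ => hf φ hφ l

/-- The exponential generating function of a weight. -/
noncomputable def weightGen (f : List ℕ → Polynomial ℚ) : Series := expGen (total f)

theorem weightGen_add (f g : List ℕ → Polynomial ℚ) :
    weightGen (fun l => f l + g l) = weightGen f + weightGen g := by
  rw [weightGen, weightGen, weightGen, ← expGen_add]
  congr 1
  funext n
  exact Finset.sum_add_distrib

/-- Splitting an arrangement at its least entry: if the weight `f` of `σ m τ`, for `m` below all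
entries of `σ` and `τ`, is a sum of products `g i σ * h i τ`, then the derivative of the generating
function of `f` is the sum of the products of the generating functions. -/
theorem dx_weightGen {ι : Type*} (s : Finset ι) (f : List ℕ → Polynomial ℚ)
    (g h : ι → List ℕ → Polynomial ℚ) (hg : ∀ i ∈ s, OrderInvariant (g i))
    (hh : ∀ i ∈ s, OrderInvariant (h i))
    (hf : ∀ (σ τ : List ℕ) (m : ℕ), (∀ i ∈ σ, m < i) → (∀ i ∈ τ, m < i) →
      f (σ ++ m :: τ) = ∑ i ∈ s, g i σ * h i τ) :
    dx (weightGen f) = ∑ i ∈ s, weightGen (g i) * weightGen (h i) := by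
  simp only [weightGen, dx_expGen, expGen_mul, ← expGen_sum]
  congr 1
  funext n
  have hr : Finset.range (n + 1) = insert 0 (Finset.Ico 1 (n + 1)) := by
    ext i; simp; omega
  have h0 : 0 ∉ Finset.Ico 1 (n + 1) := by simp
  have hcard : (Finset.Ico 1 (n + 1)).card = n := by simp
  calc total f (n + 1) = ∑ A ∈ (Finset.Ico 1 (n + 1)).powerset,
        ∑ i ∈ s, total (g i) A.card * total (h i) (n - A.card) := by
        rw [total, hr, sum_arrangements_insert h0]
        refine Finset.sum_congr rfl fun A hA => ?_
        rw [Finset.mem_powerset] at hA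
        have hpos : ∀ i ∈ Finset.Ico 1 (n + 1), 0 < i := fun i hi => (Finset.mem_Ico.mp hi).1
        have hc : (Finset.Ico 1 (n + 1) \ A).card = n - A.card := by
          rw [Finset.card_sdiff_of_subset hA, hcard]
        calc _ = ∑ σ ∈ arrangements A, ∑ τ ∈ arrangements (Finset.Ico 1 (n + 1) \ A),
              ∑ i ∈ s, g i σ * h i τ := by
              refine Finset.sum_congr rfl fun σ hσ => Finset.sum_congr rfl fun τ hτ => ?_
              refine hf σ τ 0 (fun i hi => hpos i (hA ((mem_of_mem_arrangements hσ).mp hi)))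
                fun i hi => hpos i (Finset.sdiff_subset ((mem_of_mem_arrangements hτ).mp hi))
          _ = ∑ i ∈ s, (∑ σ ∈ arrangements A, g i σ) *
              ∑ τ ∈ arrangements (Finset.Ico 1 (n + 1) \ A), h i τ := by
              simp only [Finset.sum_mul_sum]
              rw [Finset.sum_comm (s := s)]
              exact Finset.sum_congr rfl fun σ _ => Finset.sum_comm
          _ = _ := Finset.sum_congr rfl fun i hi => by
              rw [(hg i hi).sum_arrangements, (hh i hi).sum_arrangements, hc]
    _ = _ := by
        -- The summand depends only on the size of `A`; grouping by size produces the binomial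
        -- coefficients of `expGen_mul`.
        rw [Finset.sum_powerset_apply_card (fun k => ∑ i ∈ s, total (g i) k * total (h i) (n - k)),
          hcard, Finset.sum_comm]
        simp only [Finset.smul_sum]

theorem vanishesAtZero_weightGen {f : List ℕ → Polynomial ℚ} (hf : f [] = 0) :
    VanishesAtZero (weightGen f) := fun m hm => by
  rw [weightGen, coeff_expGen, hm, total, Finset.range_zero, arrangements_empty,
    Finset.sum_singleton, hf, Polynomial.coeff_zero, zero_div]

/-! ### Valleys and peaks of lists -/

/-- The middle entries `b` of the consecutive triples `a, b, c` of a list with `p a b c`. -/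
def middles {α : Type*} (p : α → α → α → Prop) [∀ a b c, Decidable (p a b c)] : List α → List α
  | a :: b :: c :: t =>
    if p a b c then b :: middles p (b :: c :: t) else middles p (b :: c :: t)
  | _ => []

/-- The entries of a list at its valleys, from left to right. -/
def valleys (l : List ℕ) : List ℕ := middles (fun a b c => b < a ∧ b < c) l

/-- The entries of a list at its peaks, from left to right. -/
def peaks (l : List ℕ) : List ℕ := middles (fun a b c => a < b ∧ c < b) l

/-- The first entry of the list exceeds the second. -/
def StartsDesc : List ℕ → Prop
  | a :: b :: _ => b < a
  | _ => False

theorem valleys_nil : valleys [] = [] := rfl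

theorem valleys_singleton (a : ℕ) : valleys [a] = [] := rfl

theorem valleys_pair (a b : ℕ) : valleys [a, b] = [] := rfl

theorem valleys_cons (a b c : ℕ) (t : List ℕ) : valleys (a :: b :: c :: t) =
    if b < a ∧ b < c then b :: valleys (b :: c :: t) else valleys (b :: c :: t) := rfl

theorem peaks_cons (a b c : ℕ) (t : List ℕ) : peaks (a :: b :: c :: t) =
    if a < b ∧ c < b then b :: peaks (b :: c :: t) else peaks (b :: c :: t) := rfl

theorem mem_of_mem_valleys : ∀ {l : List ℕ} {i : ℕ}, i ∈ valleys l → i ∈ l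
  | a :: b :: c :: t, i, h => by
    rw [valleys_cons] at h
    have ih := fun h => mem_of_mem_valleys (l := b :: c :: t) (i := i) h
    split_ifs at h
    · rcases List.mem_cons.mp h with rfl | h
      · simp
      · exact List.mem_cons_of_mem _ (ih h)
    · exact List.mem_cons_of_mem _ (ih h)

theorem valleys_map {φ : ℕ → ℕ} (hφ : StrictMono φ) :
    ∀ l : List ℕ, valleys (l.map φ) = (valleys l).map φ
  | [] => rfl
  | [_] => rfl
  | [_, _] => rfl
  | a :: b :: c :: t => by
    have ih := valleys_map hφ (b :: c :: t)
    simp only [List.map_cons] at ih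
    simp only [List.map_cons, valleys_cons, hφ.lt_iff_lt, ih]
    split_ifs <;> rfl

theorem startsDesc_map {φ : ℕ → ℕ} (hφ : StrictMono φ) :
    ∀ l : List ℕ, StartsDesc (l.map φ) ↔ StartsDesc l
  | [] => Iff.rfl
  | [_] => Iff.rfl
  | _ :: _ :: _ => hφ.lt_iff_lt

theorem valleys_cons_of_lt {m : ℕ} : ∀ {τ : List ℕ}, (∀ i ∈ τ, m < i) →
    valleys (m :: τ) = valleys τ
  | [], _ => rfl
  | [_], _ => rfl
  | a :: b :: t, h => by
    rw [valleys_cons, if_neg]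
    exact fun h' => absurd h'.1 (not_lt.mpr (h a List.mem_cons_self).le)

/-- The neighbours of the low entry `m` cannot be valleys, just as they could not be as end entries
of `σ` and `τ`. The entry `m` itself is a valley exactly when it has neighbours on both sides. -/
theorem valleys_append_cons {m : ℕ} {τ : List ℕ} (hτ : ∀ i ∈ τ, m < i) :
    ∀ {σ : List ℕ}, (∀ i ∈ σ, m < i) → valleys (σ ++ m :: τ) =
      valleys σ ++ ((if σ ≠ [] ∧ τ ≠ [] then [m] else []) ++ valleys τ)
  | [], _ => by simp [valleys_nil, valleys_cons_of_lt hτ]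
  | [a], hσ => by
    have ha := hσ a List.mem_cons_self
    have h := valleys_cons_of_lt hτ
    cases τ with
    | nil => rfl
    | cons c t =>
      have hc := hτ c List.mem_cons_self
      simp [valleys_cons, ha, hc, h, valleys_singleton]
  | [a, b], hσ => by
    have h := valleys_append_cons hτ (σ := [b]) fun i hi => hσ i (List.mem_cons_of_mem _ hi)
    have hb := hσ b (by simp)
    have hb' : ¬ b < m := hb.le.not_gt
    simp only [List.cons_append, List.nil_append] at h ⊢
    rw [valleys_cons, if_neg (fun h => hb' h.2), h]
    simp [valleys_pair, valleys_singleton]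
  | a :: b :: c :: t, hσ => by
    have h := valleys_append_cons hτ (σ := b :: c :: t)
      fun i hi => hσ i (List.mem_cons_of_mem _ hi)
    simp only [List.cons_append] at h ⊢
    rw [valleys_cons, valleys_cons, h]
    split_ifs <;> simp_all

/-- If `σ` has a single entry, the initial descent is the step down to `m`; otherwise the first two
entries lie in `σ`. -/
theorem startsDesc_append_cons {m : ℕ} {σ τ : List ℕ} (hσ : ∀ i ∈ σ, m < i) (hne : σ ≠ []) :
    StartsDesc (σ ++ m :: τ) ↔ σ.length = 1 ∨ StartsDesc σ := by
  match σ, hne with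
  | [a], _ => simpa [StartsDesc] using hσ
  | a :: b :: t, _ => simp [StartsDesc]

theorem not_startsDesc_cons {m : ℕ} {τ : List ℕ} (hτ : ∀ i ∈ τ, m < i) :
    ¬ StartsDesc (m :: τ) := by
  match τ with
  | [] => exact id
  | a :: t => exact (hτ a List.mem_cons_self).le.not_gt

theorem startsDesc_append_of_two_le {σ τ : List ℕ} (h : 2 ≤ σ.length) :
    StartsDesc (σ ++ τ) ↔ StartsDesc σ := by
  match σ with
  | a :: b :: t => exact Iff.rfl

open scoped Classical in
/-- The numbers of peaks and valleys of a list without repetitions differ by an amount that is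
determined by the two ends. -/
theorem length_peaks_add : ∀ {l : List ℕ}, l.Nodup → 2 ≤ l.length →
    (peaks l).length + (if StartsDesc l then 1 else 0) + (if StartsDesc l.reverse then 1 else 0)
      = (valleys l).length + 1
  | [a, b], h, _ => by
    have hab : a ≠ b := by simpa using h
    rcases lt_or_gt_of_ne hab with h | h
    · simp [peaks, middles, valleys, StartsDesc, h, h.not_gt]
    · simp [peaks, middles, valleys, StartsDesc, h, h.not_gt]
  | a :: b :: c :: t, h, _ => by
    have ih := length_peaks_add (l := b :: c :: t) h.of_cons (by simp)
    have hrev : StartsDesc (a :: b :: c :: t).reverse ↔ StartsDesc (b :: c :: t).reverse := by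
      rw [List.reverse_cons]
      exact startsDesc_append_of_two_le (by simp)
    have hab : a ≠ b := by
      rintro rfl
      simp at h
    have hbc : b ≠ c := by
      rintro rfl
      simp at h
    have h1 : StartsDesc (a :: b :: c :: t) ↔ b < a := Iff.rfl
    have h2 : StartsDesc (b :: c :: t) ↔ c < b := Iff.rfl
    simp only [hrev, h1, h2, peaks_cons, valleys_cons] at ih ⊢
    -- The four cases are the directions of the first two steps. Up-down adds a peak while an
    -- initial descent is lost; down-up adds a valley while one is gained; equal directions change
    -- nothing.
    rcases lt_or_gt_of_ne hab with h | h <;> rcases lt_or_gt_of_ne hbc with h' | h' <;>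
      simp only [h, h', h.not_gt, h'.not_gt, and_self, and_true, and_false, if_true, if_false,
        List.length_cons] at ih ⊢ <;> omega

/-! ### The weights of increasing lists -/

/-- The valleys of the list increase from left to right. -/
def IncList (l : List ℕ) : Prop := (valleys l).Pairwise (· < ·)

open scoped Classical in
/-- The weight `y ^ val` on the increasing lists with the property `P`. -/
noncomputable def incWeight (P : List ℕ → Prop) (l : List ℕ) : Polynomial ℚ :=
  if IncList l ∧ P l then Polynomial.X ^ (valleys l).length else 0

/-- Whether a nonempty list that is followed by a smaller entry starts with a descent is
prescribed by `a`. -/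
def Front (a : Fin 2) (l : List ℕ) : Prop :=
  l ≠ [] ∧ ((l.length = 1 ∨ StartsDesc l) ↔ a = 1)

/-- Whether the list starts with a descent and ends with an ascent is prescribed by `a`
and `b`. -/
def Ends (a b : Fin 2) (l : List ℕ) : Prop :=
  (StartsDesc l ↔ a = 1) ∧ (StartsDesc l.reverse ↔ b = 1)

/-- The list has no valleys, and satisfies `Front a`. -/
def FrontNoValley (a : Fin 2) (l : List ℕ) : Prop := valleys l = [] ∧ Front a l

theorem incList_map {φ : ℕ → ℕ} (hφ : StrictMono φ) (l : List ℕ) :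
    IncList (l.map φ) ↔ IncList l := by
  simp only [IncList, valleys_map hφ, List.pairwise_map, hφ.lt_iff_lt]

theorem orderInvariant_incWeight {P : List ℕ → Prop} (hP : OrderInvariant P) :
    OrderInvariant (incWeight P) := fun φ hφ l => by
  classical
  rw [incWeight, incWeight, valleys_map hφ, List.length_map]
  exact if_congr (and_congr (incList_map hφ l) (iff_of_eq (hP φ hφ l))) rfl rfl

theorem orderInvariant_front (a : Fin 2) : OrderInvariant (Front a) := fun φ hφ l => by
  simp only [Front, startsDesc_map hφ, List.length_map, ne_eq, List.map_eq_nil_iff]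

theorem orderInvariant_front_reverse (b : Fin 2) :
    OrderInvariant fun l => Front b l.reverse := fun φ hφ l => by
  have := orderInvariant_front b φ hφ l.reverse
  rwa [List.map_reverse] at this

theorem orderInvariant_frontNoValley (a : Fin 2) :
    OrderInvariant (FrontNoValley a) := fun φ hφ l => by
  simp only [FrontNoValley, orderInvariant_front a φ hφ l, valleys_map hφ, List.map_eq_nil_iff]

theorem orderInvariant_eq_nil : OrderInvariant fun l : List ℕ => l = [] := fun φ _ l => by
  simp only [List.map_eq_nil_iff]

/-- A valley of `σ` would precede the valley `m` and exceed it, so there is none; the valleys of `τ`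
follow `m` and exceed it automatically. -/
theorem incList_append_cons {m : ℕ} {σ τ : List ℕ} (hσ : ∀ i ∈ σ, m < i) (hτ : ∀ i ∈ τ, m < i)
    (hσ0 : σ ≠ []) (hτ0 : τ ≠ []) : IncList (σ ++ m :: τ) ↔ valleys σ = [] ∧ IncList τ := by
  rw [IncList, IncList, valleys_append_cons hτ hσ, if_pos ⟨hσ0, hτ0⟩]
  simp only [List.pairwise_append, List.pairwise_cons, List.singleton_append]
  constructor
  · rintro ⟨-, ⟨-, h⟩, h'⟩
    refine ⟨List.eq_nil_iff_forall_not_mem.mpr fun i hi => ?_, h⟩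
    exact absurd (h' i hi m List.mem_cons_self) (hσ i (mem_of_mem_valleys hi)).not_gt
  · rintro ⟨h, h'⟩
    rw [h]
    exact ⟨List.Pairwise.nil, ⟨fun i hi => hτ i (mem_of_mem_valleys hi), h'⟩, by simp⟩

theorem incList_of_valleys_eq_nil {l : List ℕ} (h : valleys l = []) : IncList l := by
  rw [IncList, h]
  exact List.Pairwise.nil

theorem incWeight_eq_nil (l : List ℕ) : incWeight (· = []) l = if l = [] then 1 else 0 := by
  split_ifs with h
  · rw [incWeight, if_pos ⟨incList_of_valleys_eq_nil (h ▸ valleys_nil), h⟩, h, valleys_nil,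
      List.length_nil, pow_zero]
  · rw [incWeight, if_neg fun h' => h h'.2]

open scoped Classical in
theorem incWeight_frontNoValley (a : Fin 2) (l : List ℕ) :
    incWeight (FrontNoValley a) l = if FrontNoValley a l then 1 else 0 := by
  split_ifs with h
  · rw [incWeight, if_pos ⟨incList_of_valleys_eq_nil h.1, h⟩, h.1, List.length_nil, pow_zero]
  · rw [incWeight, if_neg fun h' => h h'.2]

theorem ends_append_cons {m : ℕ} {σ τ : List ℕ} (hσ : ∀ i ∈ σ, m < i) (hτ : ∀ i ∈ τ, m < i)
    (hσ0 : σ ≠ []) (hτ0 : τ ≠ []) (a b : Fin 2) :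
    Ends a b (σ ++ m :: τ) ↔ Front a σ ∧ Front b τ.reverse := by
  have hr : (σ ++ m :: τ).reverse = τ.reverse ++ m :: σ.reverse := by simp
  rw [Ends, hr, startsDesc_append_cons hσ hσ0, startsDesc_append_cons (by simpa using hτ)
    (by simpa using hτ0), Front, Front]
  simp [hσ0, hτ0]

theorem ends_cons {m : ℕ} {τ : List ℕ} (hτ : ∀ i ∈ τ, m < i) (hτ0 : τ ≠ []) (a b : Fin 2) :
    Ends a b (m :: τ) ↔ a = 0 ∧ Front b τ.reverse := by
  have ha : (False ↔ a = 1) ↔ a = 0 := by fin_cases a <;> simp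
  rw [Ends, List.reverse_cons, startsDesc_append_cons (by simpa using hτ) (by simpa using hτ0),
    Front, iff_false_intro (not_startsDesc_cons hτ), ha]
  simp [hτ0]

theorem ends_append_singleton {m : ℕ} {σ : List ℕ} (hσ : ∀ i ∈ σ, m < i) (hσ0 : σ ≠ [])
    (a b : Fin 2) : Ends a b (σ ++ [m]) ↔ Front a σ ∧ b = 0 := by
  have h := ends_cons (τ := σ.reverse) (by simpa using hσ) (by simpa using hσ0) b a
  rw [List.reverse_reverse] at h
  rw [and_comm, ← h, Ends, Ends, and_comm]
  simp

theorem ends_singleton (m : ℕ) (a b : Fin 2) : Ends a b [m] ↔ a = 0 ∧ b = 0 := by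
  simp only [Ends, List.reverse_singleton, StartsDesc]
  fin_cases a <;> fin_cases b <;> simp

/-! ### Generating functions of weights -/

/-- The generating function of the increasing lists with the property `P`. -/
noncomputable def incGen (P : List ℕ → Prop) : Series := weightGen (incWeight P)

theorem weightGen_zero : weightGen (fun _ => 0) = 0 := by
  rw [weightGen, ← expGen_zero]
  congr 1
  funext n
  exact Finset.sum_const_zero

/-- Arrangements have no repeated entries, so weights need only agree on such lists;
`length_peaks_add` requires this restriction. -/
theorem weightGen_congr {f g : List ℕ → Polynomial ℚ} (h : ∀ l : List ℕ, l.Nodup → f l = g l) :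
    weightGen f = weightGen g := by
  rw [weightGen, weightGen]
  congr 1
  funext n
  exact Finset.sum_congr rfl fun l hl => h l (mem_arrangements.mp hl).1

theorem weightGen_X_mul (f : List ℕ → Polynomial ℚ) :
    weightGen (fun l => Polynomial.X * f l) = y * weightGen f := by
  ext m
  have ht : total (fun l => Polynomial.X * f l) (m 0) = Polynomial.X * total f (m 0) := by
    rw [total, total, Finset.mul_sum]
  rw [weightGen, coeff_expGen, ht, y, X, coeff_monomial_mul]
  by_cases h : m 1 = 0
  · rw [if_neg (by rw [Finsupp.single_le_iff]; omega), h, Polynomial.coeff_X_mul_zero, zero_div]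
  · rw [if_pos (by rw [Finsupp.single_le_iff]; omega), one_mul, weightGen, coeff_expGen]
    obtain ⟨k, hk⟩ := Nat.exists_eq_succ_of_ne_zero h
    simp [hk, Polynomial.coeff_X_mul]

theorem weightGen_ite (c : Prop) [Decidable c] (f : List ℕ → Polynomial ℚ) :
    weightGen (fun l => if c then f l else 0) = if c then weightGen f else 0 := by
  split_ifs
  · rfl
  · exact weightGen_zero

theorem OrderInvariant.X_mul {f : List ℕ → Polynomial ℚ} (hf : OrderInvariant f) :
    OrderInvariant fun l => Polynomial.X * f l := fun φ hφ l => by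
  simp only [hf φ hφ l]

theorem OrderInvariant.ite {f : List ℕ → Polynomial ℚ} (hf : OrderInvariant f) (c : Prop)
    [Decidable c] : OrderInvariant fun l => if c then f l else 0 := fun φ hφ l => by
  simp only [hf φ hφ l]

theorem OrderInvariant.add {f g : List ℕ → Polynomial ℚ} (hf : OrderInvariant f)
    (hg : OrderInvariant g) : OrderInvariant fun l => f l + g l := fun φ hφ l => by
  simp only [hf φ hφ l, hg φ hφ l]

theorem vanishesAtZero_incGen {P : List ℕ → Prop} (hP : ¬ P []) : VanishesAtZero (incGen P) :=
  vanishesAtZero_weightGen (by rw [incWeight, if_neg fun h => hP h.2])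

theorem incGen_eq_nil : incGen (· = []) = 1 := by
  refine eq_of_dx_eq_dx (fun m hm => ?_) ?_
  · have hc : coeff m (1 : Series) = (1 : Polynomial ℚ).coeff (m 1) := by
      rw [coeff_one, Polynomial.coeff_one]
      refine if_congr ⟨fun h => by rw [h]; rfl, fun h => ?_⟩ rfl rfl
      ext i
      fin_cases i
      · exact hm
      · exact h
    rw [map_sub, incGen, weightGen, coeff_expGen, hm, total, Finset.range_zero,
      arrangements_empty, Finset.sum_singleton, incWeight_eq_nil, if_pos rfl, hc]
    simp
  · rw [dx, pderiv_one]
    refine (dx_weightGen (ι := Empty) ∅ _ (fun _ _ => 0) (fun _ _ => 0) (by simp) (by simp)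
      fun σ τ m _ _ => ?_).trans Finset.sum_empty
    rw [incWeight_eq_nil, if_neg (by simp), Finset.sum_empty]

/-- The generating functions of the lists without valleys, split by their front, satisfy linear
differential equations. -/
theorem dx_incGen_frontNoValley (a : Fin 2) :
    dx (incGen (FrontNoValley a)) = incGen (FrontNoValley a) +
      if a = 0 then incGen (FrontNoValley 0) + incGen (FrontNoValley 1) else 1 := by
  classical
  have key := dx_weightGen Finset.univ (incWeight (FrontNoValley a))
    -- An interior least entry would be a valley, so it is last (first product, `τ` empty) or first
    -- (second product, `σ` empty). In the second case front type `1` forces the one-entry word,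
    -- while type `0` allows every nonempty valley-free `τ`.
    ![incWeight (FrontNoValley a), incWeight (· = [])]
    ![incWeight (· = []), fun τ => if a = 0 then
      incWeight (FrontNoValley 0) τ + incWeight (FrontNoValley 1) τ else incWeight (· = []) τ]
    (by
      have h := orderInvariant_incWeight (orderInvariant_frontNoValley a)
      have h' := orderInvariant_incWeight orderInvariant_eq_nil
      simp [Fin.forall_fin_two, h, h'])
    (by
      have h := fun a => orderInvariant_incWeight (orderInvariant_frontNoValley a)
      have h' := orderInvariant_incWeight orderInvariant_eq_nil
      have h'' := (h 0).add (h 1)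
      by_cases ha : a = 0 <;> simp [Fin.forall_fin_two, h', h'', ha])
    fun σ τ m hσ hτ => ?_
  · rw [incGen, key, Fin.sum_univ_two]
    simp only [Matrix.cons_val_zero, Matrix.cons_val_one]
    have h1 : weightGen (incWeight (· = [])) = 1 := incGen_eq_nil
    rw [h1, mul_one, one_mul]
    congr 1
    split_ifs
    · exact weightGen_add _ _
    · exact h1
  · rw [Fin.sum_univ_two]
    simp only [Matrix.cons_val_zero, Matrix.cons_val_one, incWeight_eq_nil,
      incWeight_frontNoValley]
    by_cases hσ0 : σ = [] <;> by_cases hτ0 : τ = []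
    · subst hσ0 hτ0
      have h1 : FrontNoValley a [m] ↔ ¬ a = 0 := by
        fin_cases a <;> simp [FrontNoValley, Front, valleys_singleton]
      have h2 : ∀ a, ¬ FrontNoValley a [] := fun a h => h.2.1 rfl
      simp only [List.nil_append, h1]
      by_cases ha : a = 0 <;> simp [h2, ha]
    · subst hσ0
      have h2 : ¬ FrontNoValley a [] := fun h => h.2.1 rfl
      have h1 : FrontNoValley a (m :: τ) ↔ a = 0 ∧ valleys τ = [] := by
        rw [FrontNoValley, valleys_cons_of_lt hτ, Front, iff_false_intro (not_startsDesc_cons hτ)]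
        fin_cases a <;> simp [hτ0]
      have h3 : (if FrontNoValley 0 τ then (1 : Polynomial ℚ) else 0) +
          (if FrontNoValley 1 τ then 1 else 0) = if valleys τ = [] then 1 else 0 := by
        simp only [FrontNoValley, Front]
        by_cases hv : valleys τ = [] <;> by_cases hs : τ.length = 1 ∨ StartsDesc τ <;>
          simp [hv, hs, hτ0]
      simp only [List.nil_append, h3, h1]
      by_cases ha : a = 0 <;> simp [h2, ha, hτ0]
    · subst hτ0
      have h1 : FrontNoValley a (σ ++ [m]) ↔ FrontNoValley a σ := by
        rw [FrontNoValley, FrontNoValley, Front, Front, valleys_append_cons hτ hσ,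
          startsDesc_append_cons hσ hσ0]
        simp [hσ0, valleys_nil]
      simp [h1, hσ0]
    · have h1 : ¬ FrontNoValley a (σ ++ m :: τ) := fun h => by
        have := h.1
        rw [valleys_append_cons hτ hσ, if_pos ⟨hσ0, hτ0⟩] at this
        simp at this
      simp [h1, hσ0, hτ0]

/-- The four terms are the cases for the position of the least entry: interior (a new valley, hence
`y`), first, last, and alone. They do not overlap because `Front` excludes the empty list. -/
theorem dx_incGen_ends (a b : Fin 2) :
    dx (incGen (Ends a b)) =
      y * incGen (FrontNoValley a) * incGen (fun l => Front b l.reverse)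
        + (if a = 0 then incGen (fun l => Front b l.reverse) else 0)
        + (if b = 0 then incGen (Front a) else 0)
        + (if a = 0 ∧ b = 0 then 1 else 0) := by
  classical
  have hFr := orderInvariant_incWeight (orderInvariant_front a)
  have hBk := orderInvariant_incWeight (orderInvariant_front_reverse b)
  have hNv := orderInvariant_incWeight (orderInvariant_frontNoValley a)
  have hNil := orderInvariant_incWeight orderInvariant_eq_nil
  have key := dx_weightGen Finset.univ (incWeight (Ends a b))
    ![fun σ => Polynomial.X * incWeight (FrontNoValley a) σ,
      fun σ => if a = 0 then incWeight (· = []) σ else 0,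
      incWeight (Front a),
      fun σ => if a = 0 ∧ b = 0 then incWeight (· = []) σ else 0]
    ![incWeight (fun l => Front b l.reverse), incWeight (fun l => Front b l.reverse),
      fun τ => if b = 0 then incWeight (· = []) τ else 0, incWeight (· = [])]
    (by
      intro i _
      fin_cases i
      exacts [hNv.X_mul, hNil.ite _, hFr, hNil.ite _])
    (by
      intro i _
      fin_cases i
      exacts [hBk, hBk, hNil.ite _, hNil])
    fun σ τ m hσ hτ => ?_
  · rw [incGen, key, Fin.sum_univ_four]
    simp only [Matrix.cons_val]
    have h1 : weightGen (incWeight (· = [])) = 1 := incGen_eq_nil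
    rw [weightGen_X_mul, weightGen_ite, weightGen_ite, weightGen_ite, h1]
    simp only [mul_one, ite_mul, one_mul, zero_mul, mul_ite, mul_zero]
    rfl
  · rw [Fin.sum_univ_four]
    simp only [Matrix.cons_val, incWeight_eq_nil, incWeight_frontNoValley]
    by_cases hσ0 : σ = [] <;> by_cases hτ0 : τ = []
    · subst hσ0 hτ0
      have h1 : ∀ b, ¬ Front b [] := fun b h => h.1 rfl
      have h2 : IncList [m] := incList_of_valleys_eq_nil (valleys_singleton m)
      simp [incWeight, ends_singleton, h1, h2, valleys_singleton, FrontNoValley]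
    · subst hσ0
      have h1 : ∀ b, ¬ Front b [] := fun b h => h.1 rfl
      have h2 : IncList (m :: τ) ↔ IncList τ := by rw [IncList, IncList, valleys_cons_of_lt hτ]
      simp [incWeight, ends_cons hτ hτ0, valleys_cons_of_lt hτ, h1, h2, hτ0, FrontNoValley,
        ← ite_and]
      exact if_congr (by tauto) rfl rfl
    · subst hτ0
      have h1 : ∀ b, ¬ Front b [] := fun b h => h.1 rfl
      have h3 : valleys (σ ++ [m]) = valleys σ := by
        rw [valleys_append_cons hτ hσ]; simp [valleys_nil]
      have h2 : IncList (σ ++ [m]) ↔ IncList σ := by rw [IncList, IncList, h3]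
      simp [incWeight, ends_append_singleton hσ hσ0, h1, h2, h3, hσ0, FrontNoValley,
        ← ite_and]
      exact if_congr (by tauto) rfl rfl
    -- In the interior case `σ` is valley-free, so the valleys are `m` and those of `τ`; the
    -- additional one accounts for the factor `X`.
    · have h3 : valleys σ = [] → (valleys (σ ++ m :: τ)).length = (valleys τ).length + 1 := by
        intro h
        rw [valleys_append_cons hτ hσ, if_pos ⟨hσ0, hτ0⟩, h]
        simp
      simp only [incWeight, ends_append_cons hσ hτ hσ0 hτ0, incList_append_cons hσ hτ hσ0 hτ0,
        FrontNoValley, hσ0, hτ0, if_false, ite_self, mul_zero, zero_mul, add_zero]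
      by_cases hv : valleys σ = []
      · rw [h3 hv]
        by_cases hF : Front a σ <;> simp [hv, hF, pow_succ']
      · simp [hv]

/-! ### Permutations as lists -/

/-- The list of values of a permutation. -/
def word {n : ℕ} (π : Equiv.Perm (Fin n)) : List ℕ := List.ofFn fun i => (π i : ℕ)

theorem sum_arrangements_range (n : ℕ) {M : Type*} [AddCommMonoid M] (f : List ℕ → M) :
    ∑ l ∈ arrangements (Finset.range n), f l = ∑ π : Equiv.Perm (Fin n), f (word π) := by
  symm
  refine Finset.sum_bij (fun π _ => word π) ?_ ?_ ?_ ?_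
  · intro π _
    refine mem_arrangements.mpr ⟨List.nodup_ofFn.mpr (Fin.val_injective.comp π.injective), ?_⟩
    ext k
    rw [List.mem_toFinset, word, List.mem_ofFn, Finset.mem_range]
    constructor
    · rintro ⟨i, rfl⟩
      exact (π i).2
    · intro hk
      exact ⟨π.symm ⟨k, hk⟩, by simp⟩
  · intro π _ π' _ h
    ext i
    exact congrFun (List.ofFn_injective h) i
  · intro l hl
    obtain ⟨hn, hS⟩ := mem_arrangements.mp hl
    have hlen : l.length = n := by
      rw [← List.toFinset_card_of_nodup hn, hS, Finset.card_range]
    subst hlen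
    have hlt (i : Fin l.length) : l.get i < l.length := by
      rw [← Finset.mem_range, ← hS, List.mem_toFinset]
      exact List.get_mem l i
    have hinj : Function.Injective fun i : Fin l.length => (⟨l.get i, hlt i⟩ : Fin l.length) :=
      fun i j h => List.nodup_iff_injective_get.mp hn (Fin.mk.inj_iff.mp h)
    refine ⟨Equiv.ofBijective _ (Finite.injective_iff_bijective.mp hinj), Finset.mem_univ _, ?_⟩
    exact List.ofFn_get l
  · intros; rfl

/-- The index `i` is the middle of three consecutive indices whose values under `f` satisfy `p`. -/
def MiddleAt {α : Type*} (p : α → α → α → Prop) {n : ℕ} (f : Fin n → α) (i : Fin n) : Prop :=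
  ∃ j k : Fin n, (j : ℕ) + 1 = i ∧ (i : ℕ) + 1 = k ∧ p (f j) (f i) (f k)

theorem not_middleAt_zero {α : Type*} (p : α → α → α → Prop) {n : ℕ} (f : Fin (n + 1) → α) :
    ¬ MiddleAt p f 0 := by
  rintro ⟨j, k, h, -⟩
  simp at h

theorem middleAt_one {α : Type*} (p : α → α → α → Prop) {n : ℕ} (f : Fin (n + 3) → α) :
    MiddleAt p f (Fin.succ 0) ↔ p (f 0) (f (Fin.succ 0)) (f (Fin.succ (Fin.succ 0))) := by
  constructor
  · rintro ⟨j, k, hj, hk, h⟩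
    obtain rfl : j = 0 := Fin.ext (by simpa using hj)
    obtain rfl : k = Fin.succ (Fin.succ 0) := Fin.ext hk.symm
    exact h
  · intro h
    exact ⟨0, Fin.succ (Fin.succ 0), rfl, rfl, h⟩

/-- Middles from the third index on are middles of the tail. Index `0` is never one and index `1` is
treated by `middleAt_one`, which together drive the induction in `middles_ofFn`. -/
theorem middleAt_succ_succ {α : Type*} (p : α → α → α → Prop) {n : ℕ} (f : Fin (n + 2) → α)
    (i : Fin n) : MiddleAt p f i.succ.succ ↔ MiddleAt p (fun i => f i.succ) i.succ := by
  constructor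
  · rintro ⟨j, k, hj, hk, h⟩
    have hj0 : j ≠ 0 := by rintro rfl; simp at hj
    have hk0 : k ≠ 0 := by rintro rfl; simp at hk
    obtain ⟨j, rfl⟩ := Fin.exists_succ_eq_of_ne_zero hj0
    obtain ⟨k, rfl⟩ := Fin.exists_succ_eq_of_ne_zero hk0
    exact ⟨j, k, by simpa using hj, by simpa using hk, h⟩
  · rintro ⟨j, k, hj, hk, h⟩
    exact ⟨j.succ, k.succ, by simpa using hj, by simpa using hk, h⟩

-- An equality of lists, not only of counts: the order of the indices is kept, so it serves both for
-- the numbers of valleys and peaks and for the condition that valleys increase.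
open scoped Classical in
theorem middles_ofFn {α : Type*} (p : α → α → α → Prop) [∀ a b c, Decidable (p a b c)] :
    ∀ {n : ℕ} (f : Fin n → α),
      middles p (List.ofFn f) = ((List.finRange n).filter fun i => MiddleAt p f i).map f
  | 0, f => by simp [middles]
  | 1, f => by simp [middles, List.finRange_succ, not_middleAt_zero]
  | 2, f => by
    have h : ¬ MiddleAt p f 1 := by
      rintro ⟨j, k, -, h, -⟩
      have := k.2
      simp at h
      omega
    simp [middles, List.finRange_succ, not_middleAt_zero, h]
  | n + 3, f => by
    have ih := middles_ofFn p fun i : Fin (n + 2) => f i.succ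
    rw [List.finRange_succ, List.filter_cons_of_neg (by simp [not_middleAt_zero]),
      List.filter_map, List.map_map] at ih
    rw [List.finRange_succ, List.filter_cons_of_neg (by simp [not_middleAt_zero]),
      List.finRange_succ, List.map_cons, List.filter_cons, List.map_map, List.filter_map]
    have hF : ((fun i => decide (MiddleAt p f i)) ∘ Fin.succ ∘ Fin.succ : Fin (n + 1) → Bool) =
        (fun i => decide (MiddleAt p (fun i => f i.succ) i)) ∘ Fin.succ := by
      funext i
      simp only [Function.comp_apply, middleAt_succ_succ]
    rw [hF]
    simp only [middleAt_one, decide_eq_true_eq]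
    simp only [List.ofFn_succ] at ih ⊢
    rw [middles, ih]
    split_ifs
    · simp only [List.map_cons, List.map_map]; rfl
    · simp only [List.map_map]; rfl

theorem card_filter_univ_eq_length {n : ℕ} (P : Fin n → Prop) [DecidablePred P] :
    (Finset.univ.filter P).card = ((List.finRange n).filter fun i => P i).length := by
  rw [Finset.card_def, Finset.filter_val, Fin.univ_def, Multiset.filter_coe, Multiset.coe_card]

theorem val_eq_length_valleys {n : ℕ} (π : Equiv.Perm (Fin n)) :
    val π = (valleys (word π)).length := by
  classical
  rw [val, card_filter_univ_eq_length, valleys, word, middles_ofFn, List.length_map]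
  congr 2
  funext i
  exact decide_eq_decide.mpr Iff.rfl

theorem peak_eq_length_peaks {n : ℕ} (π : Equiv.Perm (Fin n)) :
    peak π = (peaks (word π)).length := by
  classical
  rw [peak, card_filter_univ_eq_length, peaks, word, middles_ofFn, List.length_map]
  congr 2
  funext i
  exact decide_eq_decide.mpr Iff.rfl

theorem isIncreasing_iff_incList {n : ℕ} (π : Equiv.Perm (Fin n)) :
    IsIncreasing π ↔ IncList (word π) := by
  classical
  rw [IncList, valleys, word, middles_ofFn, List.pairwise_map, List.pairwise_filter,
    List.pairwise_iff_getElem]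
  simp only [decide_eq_true_eq]
  constructor
  · intro h i j hi hj hij hi' hj'
    exact h _ _ hi' hj' (by simpa using hij)
  · intro h i j hi hj hij
    have := h i j (by simp) (by simp) hij
    simp only [List.getElem_finRange, Fin.cast_mk, Fin.eta] at this
    exact this hi hj

theorem startsWithDescent_iff {n : ℕ} (π : Equiv.Perm (Fin n)) :
    StartsWithDescent π ↔ StartsDesc (word π) := by
  match n with
  | 0 => simp [StartsWithDescent, word, StartsDesc]
  | 1 => simp [StartsWithDescent, word, StartsDesc, List.ofFn_succ]
  | n + 2 =>
    rw [word, List.ofFn_succ, List.ofFn_succ]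
    constructor
    · rintro ⟨i, j, hi, hj, h⟩
      obtain rfl : i = 0 := Fin.ext hi
      obtain rfl : j = Fin.succ 0 := Fin.ext hj
      exact h
    · intro h
      exact ⟨0, Fin.succ 0, rfl, rfl, h⟩

theorem endsWithAscent_iff {n : ℕ} (π : Equiv.Perm (Fin n)) :
    EndsWithAscent π ↔ StartsDesc (word π).reverse := by
  -- Reversing the positions exchanges a final ascent with an initial descent.
  have hrev : (word π).reverse = word (Fin.revPerm.trans π) := by
    rw [word, word]
    refine List.ext_getElem (by simp) fun i hi hi' => ?_
    simp only [List.length_reverse, List.length_ofFn] at hi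
    simp only [List.getElem_reverse, List.getElem_ofFn, List.length_ofFn, Equiv.trans_apply,
      Fin.revPerm_apply]
    congr 2
    ext
    simp [Fin.val_rev]
    omega
  rw [hrev, ← startsWithDescent_iff]
  constructor
  · rintro ⟨i, j, hi, hj, h⟩
    exact ⟨j.rev, i.rev, by rw [Fin.val_rev]; omega, by rw [Fin.val_rev]; omega, by simpa using h⟩
  · rintro ⟨i, j, hi, hj, h⟩
    refine ⟨j.rev, i.rev, ?_, ?_, by simpa using h⟩ <;> simp only [Fin.val_rev] <;> omega

theorem mem_incAB_iff {n : ℕ} (a b : Fin 2) (π : Equiv.Perm (Fin n)) :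
    π ∈ incAB a b n ↔ IncList (word π) ∧ Ends a b (word π) := by
  rw [incAB, Finset.mem_filter, inc, Finset.mem_filter, isIncreasing_iff_incList,
    startsWithDescent_iff, endsWithAscent_iff, Ends]
  have h (c : Fin 2) (p : Prop) : (¬ p ↔ c = 0) ↔ (p ↔ c = 1) := by
    fin_cases c <;> simp
  simp only [Finset.mem_univ, true_and, h]

open scoped Classical in
theorem egf_eq_weightGen {C : (n : ℕ) → Finset (Equiv.Perm (Fin n))}
    {s : (n : ℕ) → Equiv.Perm (Fin n) → ℕ} {P : List ℕ → Prop} {t : List ℕ → ℕ}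
    (hC : ∀ n (π : Equiv.Perm (Fin n)), π ∈ C n ↔ P (word π))
    (hs : ∀ n (π : Equiv.Perm (Fin n)), s n π = t (word π)) :
    egf C s = weightGen fun l => if P l then Polynomial.X ^ t l else 0 := by
  ext m
  rw [weightGen, coeff_expGen, coeff_apply, egf]
  congr 1
  have h : ((C (m 0)).filter fun π => s (m 0) π = m 1) =
      Finset.univ.filter fun π => P (word π) ∧ t (word π) = m 1 := by
    ext π
    simp only [Finset.mem_filter, Finset.mem_univ, true_and, hC, hs]
  rw [h, total, sum_arrangements_range, Polynomial.finsetSum_coeff, Finset.card_filter,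
    Nat.cast_sum]
  refine Finset.sum_congr rfl fun π _ => ?_
  by_cases hP : P (word π)
  · simp [hP, Polynomial.coeff_X_pow, eq_comm]
  · simp [hP]

theorem I_eq_incGen (a b : Fin 2) : I a b = incGen (Ends a b) := by
  rw [I, egf_eq_weightGen (P := fun l => IncList l ∧ Ends a b l) (t := fun l => (valleys l).length)
    (fun _ π => mem_incAB_iff a b π) fun _ π => val_eq_length_valleys π]
  refine weightGen_congr fun l _ => ?_
  rw [incWeight]
  congr

open scoped Classical in
theorem Ipeak_eq_weightGen :
    Ipeak = weightGen fun l => if IncList l then Polynomial.X ^ (peaks l).length else 0 :=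
  egf_eq_weightGen (fun _ π => by rw [inc, Finset.mem_filter, isIncreasing_iff_incList]; simp)
    fun _ π => peak_eq_length_peaks π

/-! ### The system of differential equations -/

theorem incGen_of_disjoint {P Q R : List ℕ → Prop} (h : ∀ l, R l ↔ P l ∨ Q l)
    (hd : ∀ l, P l → ¬ Q l) : incGen R = incGen P + incGen Q := by
  rw [incGen, incGen, incGen, ← weightGen_add]
  congr 1
  funext l
  classical
  have h1 := h l
  have h2 := hd l
  by_cases hP : P l
  · have hQ : ¬ Q l := h2 hP
    have hR : R l := h1.mpr (Or.inl hP)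
    simp [incWeight, hP, hQ, hR]
  · by_cases hQ : Q l
    · have hR : R l := h1.mpr (Or.inr hQ)
      simp [incWeight, hP, hQ, hR]
    · have hR : ¬ R l := fun h => (h1.mp h).elim hP hQ
      simp [incWeight, hP, hQ, hR]

theorem incWeight_length_eq_one (l : List ℕ) :
    incWeight (fun l => l.length = 1) l = if l.length = 1 then 1 else 0 := by
  split_ifs with h
  · obtain ⟨a, rfl⟩ := List.length_eq_one_iff.mp h
    rw [incWeight, if_pos ⟨incList_of_valleys_eq_nil (valleys_singleton a), h⟩,
      valleys_singleton, List.length_nil, pow_zero]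
  · rw [incWeight, if_neg fun h' => h h'.2]

theorem incGen_length_eq_one : incGen (fun l => l.length = 1) = x := by
  have hNil := orderInvariant_incWeight orderInvariant_eq_nil
  refine eq_of_dx_eq_dx ((vanishesAtZero_incGen (by simp)).sub vanishesAtZero_x) ?_
  rw [dx_x, incGen, dx_weightGen (ι := Unit) {()} _ (fun _ => incWeight (· = []))
    (fun _ => incWeight (· = [])) (fun _ _ => hNil) (fun _ _ => hNil) fun σ τ m _ _ => ?_]
  · have h1 : weightGen (incWeight (· = [])) = 1 := incGen_eq_nil
    rw [Finset.sum_singleton, h1, mul_one]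
  · rw [Finset.sum_singleton]
    simp only [incWeight_length_eq_one, incWeight_eq_nil]
    by_cases hσ : σ = [] <;> by_cases hτ : τ = [] <;> simp [hσ, hτ]
    have := List.length_pos_of_ne_nil hτ
    omega

theorem startsDesc_length {l : List ℕ} (h : StartsDesc l) : 2 ≤ l.length := by
  match l with
  | _ :: _ :: _ => simp

/-- Here `T` stands for an initial descent of the list or of its reversal. It fails for lengths `0`
and `1`: front type `1` gains the singletons, giving `+ x`, while type `0` loses the singletons and
the empty list, giving `- x - 1`. -/
theorem incGen_front_eq {T : List ℕ → Prop} (hT : ∀ l, T l → 2 ≤ l.length) :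
    incGen (fun l => l ≠ [] ∧ ((l.length = 1 ∨ T l) ↔ (1 : Fin 2) = 1))
        = incGen (fun l => T l ↔ (1 : Fin 2) = 1) + x ∧
      incGen (fun l => l ≠ [] ∧ ((l.length = 1 ∨ T l) ↔ (0 : Fin 2) = 1))
        = incGen (fun l => T l ↔ (0 : Fin 2) = 1) - x - 1 := by
  have hT0 : ∀ l, l = [] → ¬ T l := fun l hl h => by simpa [hl] using hT l h
  have hT1 : ∀ l, l.length = 1 → ¬ T l := fun l hl h => by simpa [hl] using hT l h
  have hne : ∀ l : List ℕ, l.length = 1 → l ≠ [] := by rintro l h rfl; simp at h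
  have h01 : ¬ (0 : Fin 2) = 1 := by decide
  constructor
  · rw [← incGen_length_eq_one]
    refine incGen_of_disjoint (fun l => ?_) fun l => ?_ <;>
      have h0 := hT0 l <;> have h1 := hT1 l <;> have hn := hne l <;> tauto
  · rw [sub_sub, eq_sub_iff_add_eq, ← incGen_length_eq_one, ← incGen_eq_nil,
      ← incGen_of_disjoint (R := fun l => l.length = 1 ∨ l = []) (fun _ => Iff.rfl)
        (fun l => hne l)]
    symm
    refine incGen_of_disjoint (fun l => ?_) fun l => ?_ <;>
      have h0 := hT0 l <;> have h1 := hT1 l <;> have hn := hne l <;> tauto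

theorem incGen_startsDesc (a : Fin 2) :
    incGen (fun l => StartsDesc l ↔ a = 1) = incGen (Ends a 0) + incGen (Ends a 1) := by
  have h01 : ¬ (0 : Fin 2) = 1 := by decide
  refine incGen_of_disjoint (fun l => ?_) fun l => ?_ <;> unfold Ends <;> tauto

theorem incGen_startsDesc_reverse (b : Fin 2) :
    incGen (fun l => StartsDesc l.reverse ↔ b = 1) = incGen (Ends 0 b) + incGen (Ends 1 b) := by
  have h01 : ¬ (0 : Fin 2) = 1 := by decide
  refine incGen_of_disjoint (fun l => ?_) fun l => ?_ <;> unfold Ends <;> tauto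

theorem incGen_front_one : incGen (Front 1) = I 1 0 + I 1 1 + x := by
  rw [I_eq_incGen, I_eq_incGen, ← incGen_startsDesc]
  exact (incGen_front_eq fun l => startsDesc_length).1

theorem incGen_front_zero : incGen (Front 0) = I 0 0 + I 0 1 - x - 1 := by
  rw [I_eq_incGen, I_eq_incGen, ← incGen_startsDesc]
  exact (incGen_front_eq fun l => startsDesc_length).2

theorem front_reverse_eq (b : Fin 2) : (fun l => Front b l.reverse) = fun l : List ℕ =>
    l ≠ [] ∧ ((l.length = 1 ∨ StartsDesc l.reverse) ↔ b = 1) := by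
  funext l
  simp [Front]

theorem incGen_front_reverse_one :
    incGen (fun l => Front 1 l.reverse) = I 0 1 + I 1 1 + x := by
  rw [I_eq_incGen, I_eq_incGen, ← incGen_startsDesc_reverse, front_reverse_eq]
  exact (incGen_front_eq (T := fun l => StartsDesc l.reverse) fun l h => by
    simpa using startsDesc_length h).1

theorem incGen_front_reverse_zero :
    incGen (fun l => Front 0 l.reverse) = I 0 0 + I 1 0 - x - 1 := by
  rw [I_eq_incGen, I_eq_incGen, ← incGen_startsDesc_reverse, front_reverse_eq]
  exact (incGen_front_eq (T := fun l => StartsDesc l.reverse) fun l h => by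
    simpa using startsDesc_length h).2

/-- A valley-free list that starts with a descent keeps descending, so there is one such arrangement
for each positive length. -/
theorem incGen_frontNoValley_one : incGen (FrontNoValley 1) = exp x - 1 := by
  refine eq_of_dx_eq (A := 1) (B := 1)
    ((vanishesAtZero_incGen fun h => h.2.1 rfl).sub vanishesAtZero_exp_x_sub_one) ?_ ?_
  · rw [dx_incGen_frontNoValley, if_neg (by decide), one_mul]
  · rw [map_sub, dx_exp_x, dx, pderiv_one]
    ring

/-- These are the unimodal lists with an initial ascent, `2 ^ (n - 1) - 1` of them in length `n ≥
1`. -/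
theorem incGen_frontNoValley_zero :
    incGen (FrontNoValley 0) = const (1 / 2) * (exp x - 1) ^ 2 := by
  refine eq_of_dx_eq (A := 2) (B := exp x - 1) ((vanishesAtZero_incGen fun h => h.2.1 rfl).sub
    ((sq (exp x - 1) ▸ vanishesAtZero_exp_x_sub_one.mul_left _).mul_left _)) ?_ ?_
  · rw [dx_incGen_frontNoValley, if_pos rfl, incGen_frontNoValley_one]
    ring
  · simp only [Derivation.leibniz, Derivation.leibniz_pow, dx_const, map_sub, dx_exp_x, smul_eq_mul,
      nsmul_eq_mul, dx, pderiv_one]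
    push_cast
    linear_combination (exp x - 1) * const_half_mul_two

theorem vanishesAtZero_I {a b : Fin 2} (h : a = 1 ∨ b = 1) : VanishesAtZero (I a b) := by
  rw [I_eq_incGen]
  refine vanishesAtZero_incGen fun hE => ?_
  have h1 : ¬ StartsDesc [] := id
  rcases h with rfl | rfl
  · exact h1 (hE.1.mpr rfl)
  · exact h1 (hE.2.mpr rfl)

theorem vanishesAtZero_I_zero_zero_sub_one : VanishesAtZero (I 0 0 - 1) := by
  -- Expressing the difference through `Front 0` removes the empty list, the only contribution at `x
  -- = 0`.
  have h : I 0 0 - 1 = incGen (Front 0) + x - I 0 1 := by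
    rw [incGen_front_zero]; ring
  rw [h]
  exact ((vanishesAtZero_incGen fun h => h.1 rfl).add vanishesAtZero_x).sub
    (vanishesAtZero_I (Or.inr rfl))

theorem dx_I_one_one : dx (I 1 1) = y * (exp x - 1) * (I 0 1 + I 1 1 + x) := by
  rw [I_eq_incGen 1 1, dx_incGen_ends, incGen_front_reverse_one, incGen_frontNoValley_one,
    ← I_eq_incGen]
  simp

theorem dx_I_zero_one : dx (I 0 1) = y * (const (1 / 2) * (exp x - 1) ^ 2) * (I 0 1 + I 1 1 + x)
    + (I 0 1 + I 1 1 + x) := by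
  rw [I_eq_incGen 0 1, dx_incGen_ends, incGen_front_reverse_one, incGen_frontNoValley_zero,
    ← I_eq_incGen]
  simp

theorem dx_I_one_zero : dx (I 1 0) = y * (exp x - 1) * (I 0 0 + I 1 0 - x - 1)
    + (I 1 0 + I 1 1 + x) := by
  rw [I_eq_incGen 1 0, dx_incGen_ends, incGen_front_reverse_zero, incGen_frontNoValley_one,
    incGen_front_one, ← I_eq_incGen]
  simp

theorem dx_I_zero_zero : dx (I 0 0) =
    y * (const (1 / 2) * (exp x - 1) ^ 2) * (I 0 0 + I 1 0 - x - 1)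
    + (I 0 0 + I 1 0 - x - 1) + (I 0 0 + I 0 1 - x - 1) + 1 := by
  rw [I_eq_incGen 0 0, dx_incGen_ends, incGen_front_reverse_zero, incGen_frontNoValley_zero,
    incGen_front_zero, ← I_eq_incGen]
  simp

/-- Adding the equations for `I 0 1`, `I 1 1` and `x` gives a closed equation for the sum, solved by
variation of constants. The value of `E` at `x = 0` is not `1`, but only `E * Eneg = 1` is needed.
-/
theorem I_zero_one_add_I_one_one : I 0 1 + I 1 1 + x = E * integral Eneg := by
  refine eq_of_dx_eq (A := 1 + y * (exp x - 1) + const (1 / 2) * y * (exp x - 1) ^ 2) (B := 1)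
    ((((vanishesAtZero_I (Or.inr rfl)).add (vanishesAtZero_I (Or.inr rfl))).add
      vanishesAtZero_x).sub ((vanishesAtZero_integral _).mul_left _)) ?_ ?_
  · rw [map_add, map_add, dx_I_zero_one, dx_I_one_one, dx_x]
    ring
  · rw [Derivation.leibniz, dx_integral, dx_E, smul_eq_mul, smul_eq_mul, E_mul_Eneg]
    ring

theorem I_one_one_eq : I 1 1 = y * integral (E * (exp x - 1) * integral Eneg) := by
  refine eq_of_dx_eq_dx ((vanishesAtZero_I (Or.inr rfl)).sub
    ((vanishesAtZero_integral _).mul_left _)) ?_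
  rw [dx_I_one_one, Derivation.leibniz, dx_integral, dx_y, smul_zero, add_zero, smul_eq_mul,
    I_zero_one_add_I_one_one]
  ring

theorem I_one_zero_eq : I 1 0 = y * integral ((exp x - 1) * (I 0 0 + I 1 0 - x - 1))
    + integral (I 1 0 + I 1 1 + x) := by
  refine eq_of_dx_eq_dx ((vanishesAtZero_I (Or.inl rfl)).sub
    (((vanishesAtZero_integral _).mul_left _).add (vanishesAtZero_integral _))) ?_
  rw [dx_I_one_zero, map_add, Derivation.leibniz, dx_integral, dx_integral, dx_y, smul_zero,
    add_zero, smul_eq_mul]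
  ring

theorem I_zero_zero_eq : I 0 0 = 1 + x
    + const (1 / 2) * y * integral ((exp x - 1) ^ 2 * (I 0 0 + I 1 0 - x - 1))
    + integral (I 0 0 + I 1 0 - x - 1) + integral (I 0 0 + I 0 1 - x - 1) := by
  refine eq_of_dx_eq_dx ?_ ?_
  · rw [add_assoc 1 x, add_assoc 1, add_assoc 1, ← sub_sub]
    exact vanishesAtZero_I_zero_zero_sub_one.sub (((vanishesAtZero_x.add
      ((vanishesAtZero_integral _).mul_left _)).add (vanishesAtZero_integral _)).add
      (vanishesAtZero_integral _))
  · rw [dx_I_zero_zero]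
    simp only [map_add, Derivation.leibniz, dx_integral, dx_y, dx_x, dx_const,
      smul_eq_mul, dx, pderiv_one]
    ring

/-! ### Peaks -/

-- By `length_peaks_add`, the number of peaks minus the number of valleys is `1` for type `(0,0)`,
-- `0` for the mixed types and `-1` for type `(1,1)`. Lengths `0` and `1` escape this rule and
-- contribute `1 + x`.
open scoped Classical in
theorem exists_mul_eq_and_Ipeak_eq : ∃ Q : Series, y * Q = I 1 1 ∧
    Ipeak = 1 + x + y * (I 0 0 - 1 - x) + I 0 1 + Q + I 1 0 := by
  -- The quotient counts each list with one valley fewer. The natural subtraction is exact: a list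
  -- that starts with a descent and ends with an ascent has a valley.
  refine ⟨weightGen fun l => if IncList l ∧ Ends 1 1 l then
    Polynomial.X ^ ((valleys l).length - 1) else 0, ?_, ?_⟩
  · rw [← weightGen_X_mul, I_eq_incGen]
    refine weightGen_congr fun l hl => ?_
    rw [incWeight]
    split_ifs with h
    · have h1 : StartsDesc l := h.2.1.mpr rfl
      have h2 : StartsDesc l.reverse := h.2.2.mpr rfl
      have h3 := length_peaks_add hl (startsDesc_length h1)
      rw [if_pos h1, if_pos h2] at h3
      rw [← pow_succ']
      congr 1
      omega
    · exact mul_zero _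
  -- The empty list and the singletons have type `(0,0)` but no peak, so they are separated before
  -- multiplying by `y`.
  · have h0 : I 0 0 - 1 - x = incGen fun l => 2 ≤ l.length ∧ Ends 0 0 l := by
      rw [sub_sub, sub_eq_iff_eq_add, ← incGen_eq_nil, ← incGen_length_eq_one,
        ← incGen_of_disjoint (R := fun l => l = [] ∨ l.length = 1) (fun _ => Iff.rfl)
          (by rintro l rfl; simp), I_eq_incGen]
      refine incGen_of_disjoint (fun l => ?_) fun l => ?_
      · match l with
        | [] => simp [Ends, StartsDesc]
        | [a] => simp [Ends, StartsDesc]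
        | a :: b :: t => simp
      · rintro ⟨h, -⟩ (rfl | h')
        · simp at h
        · omega
    rw [h0, I_eq_incGen, I_eq_incGen, Ipeak_eq_weightGen, ← incGen_eq_nil, ← incGen_length_eq_one]
    simp only [incGen, ← weightGen_X_mul, ← weightGen_add]
    refine weightGen_congr fun l hl => ?_
    rw [incWeight_eq_nil, incWeight_length_eq_one]
    match l with
    | [] => simp [IncList, peaks, middles, valleys, incWeight, Ends, StartsDesc]
    | [a] => simp [IncList, peaks, middles, valleys, incWeight, Ends, StartsDesc]
    | a :: b :: t =>
      have hp := length_peaks_add hl (by simp)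
      have h2 : 2 ≤ (a :: b :: t).length := by simp
      generalize a :: b :: t = l at hp h2
      have hl0 : l ≠ [] := by rintro rfl; simp at h2
      have hl1 : l.length ≠ 1 := by omega
      by_cases hI : IncList l
      · by_cases hs : StartsDesc l <;> by_cases he : StartsDesc l.reverse <;>
          simp only [hs, he, if_true, if_false] at hp <;>
          simp [incWeight, hI, hs, he, hl0, hl1, h2, Ends, ← pow_succ'] <;> congr 1 <;> omega
      · simp [incWeight, hI, hl0, hl1]

end IncPerm

theorem theorem2p12 :
    -- `I 1 1` is divisible by `y`, with quotient `Q = I 1 1 / y`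
    (∃ Q : IncPerm.Series, IncPerm.y * Q = IncPerm.I 1 1 ∧
      IncPerm.Ipeak = 1 + IncPerm.x + IncPerm.y * (IncPerm.I 0 0 - 1 - IncPerm.x)
        + IncPerm.I 0 1 + Q + IncPerm.I 1 0) ∧
    IncPerm.I 0 1 =
      IncPerm.E * IncPerm.integral IncPerm.Eneg
        - IncPerm.y * IncPerm.integral
            (IncPerm.E * (IncPerm.exp IncPerm.x - 1) * IncPerm.integral IncPerm.Eneg)
        - IncPerm.x ∧
    IncPerm.I 1 1 =
      IncPerm.y * IncPerm.integral
        (IncPerm.E * (IncPerm.exp IncPerm.x - 1) * IncPerm.integral IncPerm.Eneg) ∧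
    IncPerm.I 1 0 =
      IncPerm.y * IncPerm.integral
          ((IncPerm.exp IncPerm.x - 1) * (IncPerm.I 0 0 + IncPerm.I 1 0 - IncPerm.x - 1))
        + IncPerm.integral (IncPerm.I 1 0 + IncPerm.I 1 1 + IncPerm.x) ∧
    IncPerm.I 0 0 =
      1 + IncPerm.x
        + IncPerm.const (1 / 2) * IncPerm.y * IncPerm.integral
            ((IncPerm.exp IncPerm.x - 1) ^ 2
              * (IncPerm.I 0 0 + IncPerm.I 1 0 - IncPerm.x - 1))
        + IncPerm.integral (IncPerm.I 0 0 + IncPerm.I 1 0 - IncPerm.x - 1)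
        + IncPerm.integral (IncPerm.I 0 0 + IncPerm.I 0 1 - IncPerm.x - 1) := by
  refine ⟨IncPerm.exists_mul_eq_and_Ipeak_eq, ?_, IncPerm.I_one_one_eq, IncPerm.I_one_zero_eq,
    IncPerm.I_zero_zero_eq⟩
  -- The formula for `I 0 1` is the closed form of `I 0 1 + I 1 1 + x` with `I 1 1` and `x`
  -- subtracted.
  rw [← IncPerm.I_one_one_eq, ← IncPerm.I_zero_one_add_I_one_one]
  ring
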